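/- A bigraph $F=(U_1,U_2,E)$ consists of finite sets $U_1,U_2$ and $E\subseteq U_1\times U_2$. A bigraph property $\mathcal P$ is a class of bigraphs closed under isomorphism (respecting the order of the two classes); it is hereditary if, with every bigraph, it contains all its induced sub-bigraphs (obtained by restricting to $S_1\subseteq U_1$, $S_2\subseteq U_2$). A bigraphon $(J_1,J_2,W)$ consists of probability spaces $(J_1,\pi_1)$, $(J_2,\pi_2)$ and a measurable $W:J_1\times J_2\to[0,1]$. The density of $F$ in it is $$t(F,W)=\int_{J_1^{U_1}}\int_{J_2^{U_2}}\prod_{(i,j)\in E}W(x_i,y_j)\,dy\,dx,$$ and the density $t(F,G)$ of $F$ in a bigraph $G$ with nonempty classes is the density of $F$ in $G$ viewed as a finite bigraphon with uniform measures. The bigraphon is in the closure of $\mathcal P$ if there are $G_1,G_2,\dots\in\mathcal P$ whose numbers of nodes tend to infinity such that $t(F,G_n)\to t(F,W)$ for every bigraph $F$. It is pure if $r_1(x,x')=\|W(x,\cdot)-W(x',\cdot)\|_{L_1(\pi_2)}$ and $r_2(y,y')=\|W(\cdot,y)-W(\cdot,y')\|_{L_1(\pi_1)}$ are defined for all pairs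 of points, $(J_1,r_1)$ and $(J_2,r_2)$ are complete separable metric spaces, and every nonempty open set in $J_1$ and in $J_2$ has positive measure. The packing dimension of a metric space is $\limsup_{\varepsilon\to0}\log N(\varepsilon)/\log(1/\varepsilon)$, where $N(\varepsilon)$ is the maximum number of points mutually at distance at least $\varepsilon$. **Corollary 4.3.** Let $\mathcal P$ be a hereditary bigraph property that does not contain all bigraphs. Then there is a finite number $d$, depending only on $\mathcal P$, such that for every pure bigraphon $(J_1,J_2,W)$ in the closure of $\mathcal P$: $W(x,y)\in\{0,1\}$ for almost all $(x,y)\in J_1\times J_2$; the metric spaces $(J_1,r_1)$ and $(J_2,r_2)$ are compact; and their packing dimensions are at most $d$. -/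

import Mathlib

open MeasureTheory Filter Topology
open scoped ENNReal

/-- A bigraph `(U₁, U₂, E)`: finite sets `U₁` (first class), `U₂` (second class), `E ⊆ U₁ × U₂`. -/
structure Bigraph where
  U₁ : Type
  U₂ : Type
  [fintype₁ : Fintype U₁]
  [fintype₂ : Fintype U₂]
  Adj : U₁ → U₂ → Prop

attribute [instance] Bigraph.fintype₁ Bigraph.fintype₂

namespace Bigraph

/-- Isomorphism of bigraphs (it respects the order of the two classes). -/
def IsIso (F G : Bigraph) : Prop :=
  ∃ (e₁ : F.U₁ ≃ G.U₁) (e₂ : F.U₂ ≃ G.U₂), ∀ i j, F.Adj i j ↔ G.Adj (e₁ i) (e₂ j)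

/-- The sub-bigraph of `G` induced by `S₁ ⊆ U₁` and `S₂ ⊆ U₂`. -/
def induce (G : Bigraph) (S₁ : Finset G.U₁) (S₂ : Finset G.U₂) : Bigraph where
  U₁ := {i // i ∈ S₁}
  U₂ := {j // j ∈ S₂}
  Adj i j := G.Adj i.1 j.1

/-- The density of `F` in the bigraph `G`: the probability that a uniformly random pair of maps
`U₁(F) → U₁(G)`, `U₂(F) → U₂(G)` preserves edges. This is the density of `F` in `G` viewed as a
finite bigraphon with uniform measures. -/
noncomputable def homDensity (F G : Bigraph) : ℝ :=
  (Nat.card {φ : (F.U₁ → G.U₁) × (F.U₂ → G.U₂) //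
      ∀ i j, F.Adj i j → G.Adj (φ.1 i) (φ.2 j)} : ℝ) /
    ((Fintype.card G.U₁ : ℝ) ^ Fintype.card F.U₁ * (Fintype.card G.U₂ : ℝ) ^ Fintype.card F.U₂)

/-- A hereditary bigraph property: a class of bigraphs closed under isomorphism and under taking
induced sub-bigraphs. -/
structure IsHereditary (P : Bigraph → Prop) : Prop where
  iso : ∀ F G : Bigraph, F.IsIso G → P F → P G
  induce : ∀ (G : Bigraph) (S₁ : Finset G.U₁) (S₂ : Finset G.U₂), P G → P (G.induce S₁ S₂)

end Bigraph

/-- `(J₁, J₂, W)` is a bigraphon: `J₁`, `J₂` are probability spaces and `W : J₁ × J₂ → [0, 1]` is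
measurable (with respect to the completed product σ-algebra). -/
structure IsBigraphon {J₁ J₂ : Type*} [MeasurableSpace J₁] [MeasurableSpace J₂]
    (π₁ : Measure J₁) (π₂ : Measure J₂) (W : J₁ → J₂ → ℝ) : Prop where
  prob₁ : IsProbabilityMeasure π₁
  prob₂ : IsProbabilityMeasure π₂
  aemeasurable : AEMeasurable (fun p : J₁ × J₂ => W p.1 p.2) (π₁.prod π₂)
  mem_Icc : ∀ x y, W x y ∈ Set.Icc (0 : ℝ) 1

/-- `(J₁, J₂, W)` is a pure bigraphon. The distances of the two metric spaces are the `L₁`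
distances `r₁`, `r₂` of the rows and of the columns of `W`, which are defined at every pair of
points; both spaces are complete and separable, and every nonempty open set has positive
measure. -/
structure IsPureBigraphon {J₁ J₂ : Type*} [MeasurableSpace J₁] [MeasurableSpace J₂]
    [MetricSpace J₁] [MetricSpace J₂]
    (π₁ : Measure J₁) (π₂ : Measure J₂) (W : J₁ → J₂ → ℝ) : Prop
    extends IsBigraphon π₁ π₂ W where
  aemeasurable_row : ∀ x, AEMeasurable (fun y => W x y) π₂
  aemeasurable_col : ∀ y, AEMeasurable (fun x => W x y) π₁
  dist_eq₁ : ∀ x x' : J₁, dist x x' = ∫ y, |W x y - W x' y| ∂π₂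
  dist_eq₂ : ∀ y y' : J₂, dist y y' = ∫ x, |W x y - W x y'| ∂π₁
  complete₁ : CompleteSpace J₁
  complete₂ : CompleteSpace J₂
  separable₁ : TopologicalSpace.SeparableSpace J₁
  separable₂ : TopologicalSpace.SeparableSpace J₂
  open_pos₁ : π₁.IsOpenPosMeasure
  open_pos₂ : π₂.IsOpenPosMeasure

open Classical in
/-- The density of the bigraph `F` in the bigraphon `(J₁, J₂, W)`, namely
`∫ ∫ ∏_{ij ∈ E(F)} W(x_i, y_j) dy dx`. -/
noncomputable def bigraphonDensity {J₁ J₂ : Type*} [MeasurableSpace J₁] [MeasurableSpace J₂]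
    (F : Bigraph) (π₁ : Measure J₁) (π₂ : Measure J₂) (W : J₁ → J₂ → ℝ) : ℝ :=
  ∫ x : F.U₁ → J₁, (∫ y : F.U₂ → J₂,
    (∏ i, ∏ j, if F.Adj i j then W (x i) (y j) else 1) ∂Measure.pi fun _ => π₂)
    ∂Measure.pi fun _ => π₁

/-- The growing bigraph sequence `G` converges to the bigraphon `(J₁, J₂, W)`: the number of nodes
tends to infinity and the density of every bigraph `F` in `G n` tends to its density in `W`. (The
one-point bigraphs `F` force both classes of `G n` to be nonempty for all large `n`.) -/
structure ConvergesToBigraphon {J₁ J₂ : Type*} [MeasurableSpace J₁] [MeasurableSpace J₂]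
    (G : ℕ → Bigraph) (π₁ : Measure J₁) (π₂ : Measure J₂) (W : J₁ → J₂ → ℝ) : Prop where
  growing : Tendsto (fun n => Fintype.card (G n).U₁ + Fintype.card (G n).U₂) atTop atTop
  tendsto : ∀ F : Bigraph,
    Tendsto (fun n => F.homDensity (G n)) atTop (𝓝 (bigraphonDensity F π₁ π₂ W))

/-- The bigraphon `(J₁, J₂, W)` is in the closure of the bigraph property `P`. -/
def InClosure {J₁ J₂ : Type*} [MeasurableSpace J₁] [MeasurableSpace J₂]
    (P : Bigraph → Prop) (π₁ : Measure J₁) (π₂ : Measure J₂) (W : J₁ → J₂ → ℝ) : Prop :=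
  ∃ G : ℕ → Bigraph, (∀ n, P (G n)) ∧ ConvergesToBigraphon G π₁ π₂ W

/-- `N(ε)`: the maximum number (possibly infinite) of points of `M` mutually at distance at least
`ε`. -/
noncomputable def packingCount (M : Type*) [MetricSpace M] (ε : ℝ) : ℕ∞ :=
  ⨆ (S : Finset M) (_ : ∀ x ∈ S, ∀ y ∈ S, x ≠ y → ε ≤ dist x y), (S.card : ℕ∞)

/-- The (upper) packing dimension `limsup_{ε → 0} log N(ε) / log (1/ε)`. -/
noncomputable def packingDim (M : Type*) [MetricSpace M] : EReal :=
  limsup (fun ε : ℝ => ENNReal.log (packingCount M ε : ℝ≥0∞) / ((Real.log (1 / ε) : ℝ) : EReal))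
    (𝓝[>] 0)

/-! A bigraph `F` missing from `P` is an induced sub-bigraph of the membership bigraph of `V = U₁ ⊕
U₂`, and of its flip, so both are missing from `P`. They are twin-free, so even non-injective maps
yield no induced copy in a member of `P`: their induced densities vanish exactly. Induced densities
are linear combinations of homomorphism densities, so they vanish on `W` too
(`IsBigraphon.ae_exists_of_inClosure`). Hence a random sample almost surely has an entry equal to 0
or 1 that contradicts the membership pattern. A Fubini argument then makes `W` 0-1 valued almost
everywhere.

For the metric claims, move `N` separated points to nearby generic ones and sample `m` points of the
other class, with `m` of order `log N / ε`. With positive probability the sampled rows are distinct,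
and no copy of `V` is shattered, so Sauer–Shelah gives `N ≤ (m + 1) ^ K`. Thus `N` is polynomial in
`1 / ε` (`card_le_of_separated`), uniformly in `W`. This gives total boundedness and the bound on
the dimension; the flip serves the second class. -/

namespace Bigraph

/-! ### Twin-free bigraphs missing from a hereditary property -/

/-- No two vertices of the same class have the same neighbours. -/
structure IsTwinFree (F : Bigraph) : Prop where
  left : ∀ i i', (∀ j, F.Adj i j ↔ F.Adj i' j) → i = i'
  right : ∀ j j', (∀ i, F.Adj i j ↔ F.Adj i j') → j = j'

/-- The bigraph on the vertices of `F` with edge set `t`. -/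
def withEdges (F : Bigraph) (t : Finset (F.U₁ × F.U₂)) : Bigraph where
  U₁ := F.U₁
  U₂ := F.U₂
  Adj i j := (i, j) ∈ t

/-- The membership bigraph between the subsets of `V` and the elements of `V`. -/
def ofSubsets (V : Type) [Fintype V] : Bigraph where
  U₁ := Finset V
  U₂ := V
  Adj s v := v ∈ s

/-- The bigraph with the two classes exchanged. -/
def flip (F : Bigraph) : Bigraph where
  U₁ := F.U₂
  U₂ := F.U₁
  Adj j i := F.Adj i j

lemma IsTwinFree.flip {F : Bigraph} (h : F.IsTwinFree) : F.flip.IsTwinFree :=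
  ⟨h.right, h.left⟩

lemma isTwinFree_ofSubsets (V : Type) [Fintype V] : (ofSubsets V).IsTwinFree where
  left _ _ h := Finset.ext h
  right v w h := by
    have := (h ({v} : Finset V)).1 (Finset.mem_singleton_self v)
    exact (Finset.mem_singleton.1 this).symm

lemma IsHereditary.of_embedding {P : Bigraph → Prop} (hP : IsHereditary P) {F G : Bigraph}
    {f : F.U₁ → G.U₁} {g : F.U₂ → G.U₂} (hf : f.Injective) (hg : g.Injective)
    (h : ∀ i j, F.Adj i j ↔ G.Adj (f i) (g j)) (hG : P G) : P F := by
  classical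
  let e₁ := Equiv.ofInjective f hf
  let e₂ := Equiv.ofInjective g hg
  have h₁ : ∀ a, a ∈ Finset.univ.image f ↔ a ∈ Set.range f := by simp
  have h₂ : ∀ a, a ∈ Finset.univ.image g ↔ a ∈ Set.range g := by simp
  let E₁ := e₁.trans (Equiv.subtypeEquivRight h₁).symm
  let E₂ := e₂.trans (Equiv.subtypeEquivRight h₂).symm
  have k₁ (a) : f (E₁.symm a) = a.1 := congrArg Subtype.val (E₁.apply_symm_apply a)
  have k₂ (a) : g (E₂.symm a) = a.1 := congrArg Subtype.val (E₂.apply_symm_apply a)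
  have key (a b) : G.Adj a.1 b.1 ↔ F.Adj (E₁.symm a) (E₂.symm b) := by
    rw [h, k₁, k₂]
  exact hP.iso _ _ ⟨E₁.symm, E₂.symm, key⟩
    (hP.induce G (Finset.univ.image f) (Finset.univ.image g) hG)

/-- Twin-freeness forces such maps to be injective. This matters because densities count all maps,
injective or not. -/
lemma IsHereditary.not_adj_iff_of_isTwinFree {P : Bigraph → Prop} (hP : IsHereditary P)
    {F G : Bigraph} (hF : F.IsTwinFree) (hPF : ¬ P F) (hG : P G)
    (f : F.U₁ → G.U₁) (g : F.U₂ → G.U₂) : ¬ ∀ i j, F.Adj i j ↔ G.Adj (f i) (g j) := by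
  intro h
  refine hPF (hP.of_embedding (f := f) (g := g) ?_ ?_ h hG)
  · intro i i' hi
    exact hF.left _ _ fun j => by rw [h, h, hi]
  · intro j j' hj
    exact hF.right _ _ fun i => by rw [h, h, hj]

lemma IsHereditary.exists_not_ofSubsets {P : Bigraph → Prop} (hP : IsHereditary P)
    (hne : ∃ F, ¬ P F) :
    ∃ (V : Type) (_ : Fintype V), ¬ P (ofSubsets V) ∧ ¬ P (ofSubsets V).flip := by
  classical
  obtain ⟨F, hF⟩ := hne
  refine ⟨F.U₁ ⊕ F.U₂, inferInstance, fun h => hF ?_, fun h => hF ?_⟩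
  -- Adding `inl i` to the neighbourhood of `i` keeps the sets distinct even when `F` has twins.
  · refine hP.of_embedding (G := ofSubsets (F.U₁ ⊕ F.U₂))
      (f := fun i => (Finset.univ.filter fun v => v = Sum.inl i ∨ ∃ j, v = Sum.inr j ∧ F.Adj i j :
        Finset (F.U₁ ⊕ F.U₂))) (g := fun j => (Sum.inr j : F.U₁ ⊕ F.U₂)) ?_ ?_ ?_ h
    · intro i i' hi
      have := Finset.ext_iff.1 hi (Sum.inl i)
      simpa using this
    · exact Sum.inr_injective
    · intro i j
      simp [ofSubsets]
  · refine hP.of_embedding (G := (ofSubsets (F.U₁ ⊕ F.U₂)).flip)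
      (g := fun j => (Finset.univ.filter fun v => v = Sum.inr j ∨ ∃ i, v = Sum.inl i ∧ F.Adj i j :
        Finset (F.U₁ ⊕ F.U₂))) (f := fun i => (Sum.inl i : F.U₁ ⊕ F.U₂)) ?_ ?_ ?_ h
    · exact Sum.inl_injective
    · intro i i' hi
      have := Finset.ext_iff.1 hi (Sum.inr i)
      simpa using this
    · intro i j
      simp [ofSubsets, flip]

/-! ### Induced densities as combinations of homomorphism densities -/

open Classical in
/-- The product whose integral is the density of `F`. -/
noncomputable def homWeight (F : Bigraph) (w : F.U₁ → F.U₂ → ℝ) : ℝ :=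
  ∏ i, ∏ j, if F.Adj i j then w i j else 1

open Classical in
/-- The product whose integral is the induced density of `F`. -/
noncomputable def indWeight (F : Bigraph) (w : F.U₁ → F.U₂ → ℝ) : ℝ :=
  ∏ i, ∏ j, if F.Adj i j then w i j else 1 - w i j

/-- Inclusion–exclusion: each factor is `1 * w + 0` or `-1 * w + 1`, and the product is expanded
over the set `t` of pairs contributing `w`. -/
lemma exists_indWeight_eq_sum (F : Bigraph) : ∃ c : Finset (F.U₁ × F.U₂) → ℝ,
    ∀ w : F.U₁ → F.U₂ → ℝ, F.indWeight w = ∑ t, c t * (F.withEdges t).homWeight w := by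
  classical
  refine ⟨fun t => (∏ p ∈ t, if F.Adj p.1 p.2 then 1 else -1) *
    ∏ p ∈ Finset.univ \ t, if F.Adj p.1 p.2 then 0 else 1, fun w => ?_⟩
  have h : F.indWeight w = ∏ p : F.U₁ × F.U₂,
      ((if F.Adj p.1 p.2 then 1 else -1) * w p.1 p.2 + if F.Adj p.1 p.2 then 0 else 1) := by
    rw [indWeight, Fintype.prod_prod_type]
    refine Finset.prod_congr rfl fun i _ => Finset.prod_congr rfl fun j _ => ?_
    split_ifs <;> ring
  rw [h, Finset.prod_add, Finset.powerset_univ]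
  refine Finset.sum_congr rfl fun t _ => ?_
  have ht : (F.withEdges t).homWeight w = ∏ p ∈ t, w p.1 p.2 := by
    have : (F.withEdges t).homWeight w =
        ∏ p : F.U₁ × F.U₂, if p ∈ t then w p.1 p.2 else 1 := by
      rw [Fintype.prod_prod_type]
      refine Finset.prod_congr rfl fun i _ => Finset.prod_congr rfl fun j _ => ?_
      exact if_congr Iff.rfl rfl rfl
    rw [this, Finset.prod_ite_mem, Finset.univ_inter]
  rw [ht, Finset.prod_mul_distrib]
  ring

open Classical in
lemma homDensity_eq_sum (F G : Bigraph) :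
    F.homDensity G = (∑ φ : (F.U₁ → G.U₁) × (F.U₂ → G.U₂),
      F.homWeight fun i j => if G.Adj (φ.1 i) (φ.2 j) then 1 else 0) /
    ((Fintype.card G.U₁ : ℝ) ^ Fintype.card F.U₁ *
      (Fintype.card G.U₂ : ℝ) ^ Fintype.card F.U₂) := by
  rw [homDensity]
  congr 1
  rw [Nat.card_eq_fintype_card, Fintype.card_subtype, Finset.card_filter, Nat.cast_sum]
  refine Finset.sum_congr rfl fun φ _ => ?_
  rw [homWeight]
  split_ifs with h
  · rw [Nat.cast_one, eq_comm]
    refine Finset.prod_eq_one fun i _ => Finset.prod_eq_one fun j _ => ?_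
    split_ifs with h1 h2
    exacts [rfl, absurd (h i j h1) h2, rfl]
  · push Not at h
    obtain ⟨i, j, h1, h2⟩ := h
    rw [Nat.cast_zero, eq_comm]
    refine Finset.prod_eq_zero (Finset.mem_univ i) (Finset.prod_eq_zero (Finset.mem_univ j) ?_)
    rw [if_pos h1, if_neg h2]

lemma sum_mul_homDensity_eq_zero {P : Bigraph → Prop} (hP : IsHereditary P)
    {F G : Bigraph} (hF : F.IsTwinFree) (hPF : ¬ P F) (hG : P G)
    {c : Finset (F.U₁ × F.U₂) → ℝ}
    (hc : ∀ w : F.U₁ → F.U₂ → ℝ, F.indWeight w = ∑ t, c t * (F.withEdges t).homWeight w) :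
    ∑ t, c t * (F.withEdges t).homDensity G = 0 := by
  classical
  simp_rw [homDensity_eq_sum, ← mul_div_assoc, Finset.mul_sum]
  change ∑ t, (∑ φ : (F.U₁ → G.U₁) × (F.U₂ → G.U₂), c t * (F.withEdges t).homWeight fun i j =>
    if G.Adj (φ.1 i) (φ.2 j) then 1 else 0) / ((Fintype.card G.U₁ : ℝ) ^ Fintype.card F.U₁ *
      (Fintype.card G.U₂ : ℝ) ^ Fintype.card F.U₂) = 0
  rw [← Finset.sum_div, Finset.sum_comm]
  have (φ : (F.U₁ → G.U₁) × (F.U₂ → G.U₂)) :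
      ∑ t, c t * ((F.withEdges t).homWeight fun i j =>
        if G.Adj (φ.1 i) (φ.2 j) then 1 else 0) = 0 := by
    refine (hc fun i j => if G.Adj (φ.1 i) (φ.2 j) then 1 else 0).symm.trans ?_
    have h := hP.not_adj_iff_of_isTwinFree hF hPF hG φ.1 φ.2
    push Not at h
    obtain ⟨i, j, h⟩ := h
    refine Finset.prod_eq_zero (Finset.mem_univ i) (Finset.prod_eq_zero (Finset.mem_univ j) ?_)
    rcases h with ⟨h1, h2⟩ | ⟨h1, h2⟩
    · simp [h1, h2]
    · simp [h1, h2]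
  rw [Finset.sum_congr rfl fun φ _ => this φ]
  simp

end Bigraph

/-! ### Passing to the limit bigraphon -/

section Density

variable {J₁ J₂ : Type*} [MeasurableSpace J₁] [MeasurableSpace J₂]
  {π₁ : Measure J₁} {π₂ : Measure J₂} {W : J₁ → J₂ → ℝ}

lemma Bigraph.homWeight_mem_Icc (F : Bigraph) {w : F.U₁ → F.U₂ → ℝ}
    (hw : ∀ i j, w i j ∈ Set.Icc (0 : ℝ) 1) : F.homWeight w ∈ Set.Icc (0 : ℝ) 1 := by
  classical
  have h (i j) : (if F.Adj i j then w i j else 1) ∈ Set.Icc (0 : ℝ) 1 := by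
    split_ifs
    exacts [hw i j, ⟨zero_le_one, le_rfl⟩]
  exact ⟨Finset.prod_nonneg fun i _ => Finset.prod_nonneg fun j _ => (h i j).1,
    Finset.prod_le_one (fun i _ => Finset.prod_nonneg fun j _ => (h i j).1)
      fun i _ => Finset.prod_le_one (fun j _ => (h i j).1) fun j _ => (h i j).2⟩

lemma IsBigraphon.aemeasurable_eval (hW : IsBigraphon π₁ π₂ W) {ι κ : Type*} [Fintype ι]
    [Fintype κ] (i : ι) (j : κ) :
    AEMeasurable (fun p : (ι → J₁) × (κ → J₂) => W (p.1 i) (p.2 j))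
      ((Measure.pi fun _ => π₁).prod (Measure.pi fun _ => π₂)) := by
  have := hW.prob₁
  have := hW.prob₂
  exact hW.aemeasurable.comp_quasiMeasurePreserving
    ((measurePreserving_eval (fun _ : ι => π₁) i).prod
      (measurePreserving_eval (fun _ : κ => π₂) j)).quasiMeasurePreserving

lemma IsBigraphon.integrable_homWeight (hW : IsBigraphon π₁ π₂ W) (F : Bigraph) :
    Integrable (fun p : (F.U₁ → J₁) × (F.U₂ → J₂) => F.homWeight fun i j => W (p.1 i) (p.2 j))
      ((Measure.pi fun _ => π₁).prod (Measure.pi fun _ => π₂)) := by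
  classical
  have := hW.prob₁
  have := hW.prob₂
  refine Integrable.of_bound (C := 1) (AEMeasurable.aestronglyMeasurable ?_)
    (Eventually.of_forall fun p => ?_)
  · refine Finset.aemeasurable_fun_prod _ fun i _ => Finset.aemeasurable_fun_prod _ fun j _ => ?_
    split_ifs
    exacts [hW.aemeasurable_eval i j, aemeasurable_const]
  · have := F.homWeight_mem_Icc (w := fun i j => W (p.1 i) (p.2 j)) fun i j => hW.mem_Icc _ _
    rw [Real.norm_of_nonneg this.1]
    exact this.2

lemma IsBigraphon.bigraphonDensity_eq (hW : IsBigraphon π₁ π₂ W) (F : Bigraph) :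
    bigraphonDensity F π₁ π₂ W = ∫ p : (F.U₁ → J₁) × (F.U₂ → J₂),
      (F.homWeight fun i j => W (p.1 i) (p.2 j))
      ∂((Measure.pi fun _ => π₁).prod (Measure.pi fun _ => π₂)) := by
  have := hW.prob₁
  have := hW.prob₂
  rw [integral_prod _ (hW.integrable_homWeight F)]
  rfl

/-- A twin-free bigraph missing from `P` is almost surely not sampled from a bigraphon in the
closure of `P`. -/
lemma IsBigraphon.ae_exists_of_inClosure (hW : IsBigraphon π₁ π₂ W) {P : Bigraph → Prop}
    (hP : Bigraph.IsHereditary P) (hcl : InClosure P π₁ π₂ W) {F : Bigraph} (hF : F.IsTwinFree)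
    (hPF : ¬ P F) :
    ∀ᵐ p : (F.U₁ → J₁) × (F.U₂ → J₂)
      ∂((Measure.pi fun _ => π₁).prod (Measure.pi fun _ => π₂)),
      ∃ i j, F.Adj i j ∧ W (p.1 i) (p.2 j) = 0 ∨ ¬ F.Adj i j ∧ W (p.1 i) (p.2 j) = 1 := by
  classical
  obtain ⟨c, hc⟩ := F.exists_indWeight_eq_sum
  obtain ⟨G, hG, hlim⟩ := hcl
  -- The combination is exactly zero along the sequence, hence zero in the limit.
  have h0 : ∑ t, c t * bigraphonDensity (F.withEdges t) π₁ π₂ W = 0 := by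
    refine tendsto_nhds_unique
      (tendsto_finsetSum _ fun t _ => (hlim.tendsto (F.withEdges t)).const_mul (c t)) ?_
    simp_rw [Bigraph.sum_mul_homDensity_eq_zero hP hF hPF (hG _) hc]
    exact tendsto_const_nhds
  let f (t : Finset (F.U₁ × F.U₂)) (p : (F.U₁ → J₁) × (F.U₂ → J₂)) : ℝ :=
    c t * (F.withEdges t).homWeight fun i j => W (p.1 i) (p.2 j)
  have hint (t) (_ : t ∈ Finset.univ) : Integrable (f t)
      ((Measure.pi fun _ => π₁).prod (Measure.pi fun _ => π₂)) :=
    (hW.integrable_homWeight (F.withEdges t)).const_mul (c t)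
  have hI := integrable_finsetSum _ hint
  have h1 := integral_finsetSum _ hint
  have h2 (t) : ∫ p, f t p ∂((Measure.pi fun _ => π₁).prod (Measure.pi fun _ => π₂)) =
      c t * bigraphonDensity (F.withEdges t) π₁ π₂ W := by
    rw [hW.bigraphonDensity_eq]
    exact integral_const_mul _ _
  simp_rw [h2, h0] at h1
  have hnn (p : (F.U₁ → J₁) × (F.U₂ → J₂)) (i j) :
      0 ≤ if F.Adj i j then W (p.1 i) (p.2 j) else 1 - W (p.1 i) (p.2 j) := by
    have := hW.mem_Icc (p.1 i) (p.2 j)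
    split_ifs
    exacts [this.1, sub_nonneg.2 this.2]
  -- The induced weight is nonnegative with zero integral, so almost surely one of its factors
  -- vanishes.
  have hae := (integral_eq_zero_iff_of_nonneg (fun p => ?_) hI).1 h1
  · filter_upwards [hae] with p hp
    have hp' := (hc fun i j => W (p.1 i) (p.2 j)).trans hp
    obtain ⟨i, -, hi⟩ := Finset.prod_eq_zero_iff.1 hp'
    obtain ⟨j, -, hj⟩ := Finset.prod_eq_zero_iff.1 hi
    refine ⟨i, j, ?_⟩
    split_ifs at hj with h
    · exact Or.inl ⟨h, hj⟩
    · exact Or.inr ⟨h, by linarith⟩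
  · refine le_of_le_of_eq ?_ (hc fun i j => W (p.1 i) (p.2 j))
    exact Finset.prod_nonneg fun i _ => Finset.prod_nonneg fun j _ => hnn p i j

end Density

/-! ### Almost-everywhere statements on powers of probability spaces -/

section Product

variable {J₁ J₂ : Type*} [MeasurableSpace J₁] [MeasurableSpace J₂]
  {π₁ : Measure J₁} {π₂ : Measure J₂}

lemma measurePreserving_pi_comp {ι κ : Type*} [Fintype ι] [Fintype κ] (π : Measure J₁)
    [IsProbabilityMeasure π] {g : κ → ι} (hg : g.Injective) :
    MeasurePreserving (fun (x : ι → J₁) k => x (g k)) (Measure.pi fun _ => π)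
      (Measure.pi fun _ => π) := by
  classical
  have hm : Measurable (fun (x : ι → J₁) k => x (g k)) := by fun_prop
  refine ⟨hm, (Measure.pi_eq fun s hs => ?_).symm⟩
  rw [Measure.map_apply hm (MeasurableSet.univ_pi hs)]
  -- The preimage is again a box: side `s k` at the coordinate `g k`, and the whole space off the
  -- range of `g`.
  have h : (fun (x : ι → J₁) k => x (g k)) ⁻¹' Set.univ.pi s =
      Set.univ.pi fun i => ⋂ k, {a | g k = i → a ∈ s k} := by
    ext x
    simp only [Set.mem_preimage, Set.mem_pi, Set.mem_univ, true_imp_iff, Set.mem_iInter,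
      Set.mem_ofPred_eq]
    exact ⟨fun h i k hk => hk ▸ h k, fun h k => h _ k rfl⟩
  rw [h, Measure.pi_pi]
  have h1 (i : ι) (hi : i ∉ Finset.univ.image g) :
      π (⋂ k, {a | g k = i → a ∈ s k}) = 1 := by
    have : (⋂ k, {a | g k = i → a ∈ s k}) = Set.univ := by
      refine Set.eq_univ_of_forall fun a => Set.mem_iInter.2 fun k hk => ?_
      exact absurd (Finset.mem_image.2 ⟨k, Finset.mem_univ _, hk⟩) hi
    rw [this, measure_univ]
  rw [← Finset.prod_subset (Finset.subset_univ (Finset.univ.image g)) fun i _ hi => h1 i hi,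
    Finset.prod_image fun a _ b _ h => hg h]
  refine Finset.prod_congr rfl fun k _ => congrArg π ?_
  ext a
  simp only [Set.mem_iInter, Set.mem_ofPred_eq]
  exact ⟨fun h => h k rfl, fun h k' hk' => hg hk' ▸ h⟩

/-- If almost surely a random tuple has a coordinate satisfying `p`, then almost every point
satisfies `p`. -/
lemma ae_of_ae_pi_exists {ι : Type*} [Fintype ι] [SigmaFinite π₁] {p : J₁ → Prop}
    (h : ∀ᵐ x : ι → J₁ ∂(Measure.pi fun _ => π₁), ∃ i, p (x i)) : ∀ᵐ a ∂π₁, p a := by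
  have h' : (Measure.pi fun _ : ι => π₁) (Set.univ.pi fun _ => {a | ¬ p a}) = 0 := by
    rw [← ae_iff.1 h]
    congr 1
    ext x
    simp
  rw [Measure.pi_pi] at h'
  obtain ⟨i, -, hi⟩ := Finset.prod_eq_zero_iff.1 h'
  exact ae_iff.2 hi

/-- The one-class statement is applied twice: to the second class for fixed `x`, then, after
exchanging the quantifiers, to the first class for fixed `b`. -/
lemma ae_prod_of_ae_pi_exists {ι κ : Type*} [Fintype ι] [Fintype κ] [IsProbabilityMeasure π₁]
    [IsProbabilityMeasure π₂] {p : J₁ × J₂ → Prop} (hp : MeasurableSet {z | p z})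
    (h : ∀ᵐ z : (ι → J₁) × (κ → J₂) ∂((Measure.pi fun _ => π₁).prod (Measure.pi fun _ => π₂)),
      ∃ i j, p (z.1 i, z.2 j)) : ∀ᵐ z ∂(π₁.prod π₂), p z := by
  have h1 : ∀ᵐ x : ι → J₁ ∂(Measure.pi fun _ => π₁), ∀ᵐ b ∂π₂, ∃ i, p (x i, b) := by
    filter_upwards [Measure.ae_ae_of_ae_prod h] with x hx
    refine ae_of_ae_pi_exists (ι := κ) ?_
    filter_upwards [hx] with y hy
    obtain ⟨i, j, hij⟩ := hy
    exact ⟨j, i, hij⟩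
  have hmeas : MeasurableSet {z : (ι → J₁) × J₂ | ∃ i, p (z.1 i, z.2)} := by
    have : {z : (ι → J₁) × J₂ | ∃ i, p (z.1 i, z.2)} =
        ⋃ i, (fun z : (ι → J₁) × J₂ => (z.1 i, z.2)) ⁻¹' {z | p z} := by
      ext z
      simp
    rw [this]
    exact MeasurableSet.iUnion fun i => hp.preimage (by fun_prop)
  have h2 := (Measure.ae_ae_comm (p := fun (x : ι → J₁) b => ∃ i, p (x i, b)) hmeas).1 h1
  rw [Measure.ae_prod_iff_ae_ae hp, Measure.ae_ae_comm (p := fun a b => p (a, b)) hp]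
  filter_upwards [h2] with b hb
  exact ae_of_ae_pi_exists (p := fun a => p (a, b)) hb

lemma IsBigraphon.ae_zero_or_one {W : J₁ → J₂ → ℝ} (hW : IsBigraphon π₁ π₂ W) {ι κ : Type*}
    [Fintype ι] [Fintype κ]
    (h : ∀ᵐ z : (ι → J₁) × (κ → J₂) ∂((Measure.pi fun _ => π₁).prod (Measure.pi fun _ => π₂)),
      ∃ i j, W (z.1 i) (z.2 j) = 0 ∨ W (z.1 i) (z.2 j) = 1) :
    ∀ᵐ z ∂(π₁.prod π₂), W z.1 z.2 = 0 ∨ W z.1 z.2 = 1 := by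
  have := hW.prob₁
  have := hW.prob₂
  -- Exchanging quantifiers needs a measurable set, so `W` is replaced by a measurable version.
  obtain ⟨f, hf, hWf⟩ := hW.aemeasurable
  have hev (i : ι) (j : κ) := ((measurePreserving_eval (fun _ : ι => π₁) i).prod
    (measurePreserving_eval (fun _ : κ => π₂) j)).quasiMeasurePreserving.ae hWf
  have hmeas : MeasurableSet {z | f z = 0 ∨ f z = 1} :=
    (hf (measurableSet_singleton 0)).union (hf (measurableSet_singleton 1))
  have key : ∀ᵐ z ∂(π₁.prod π₂), f z = 0 ∨ f z = 1 := by
    refine ae_prod_of_ae_pi_exists (ι := ι) (κ := κ) hmeas ?_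
    filter_upwards [h, eventually_all.2 fun i => eventually_all.2 fun j => hev i j]
      with z ⟨i, j, hz⟩ hz'
    refine ⟨i, j, ?_⟩
    have := hz' i j
    simp only [Function.eval, Prod.map] at this
    rwa [← this]
  filter_upwards [key, hWf] with z hz hz'
  rwa [hz']

end Product

/-! ### Sauer–Shelah and the choice of sample size -/

section Sampling

lemma sum_choose_le_pow (m K : ℕ) : ∑ i ∈ Finset.Iic K, m.choose i ≤ (m + 1) ^ K := by
  rw [add_pow, Nat.range_succ_eq_Iic]
  refine Finset.sum_le_sum fun i hi => ?_
  rw [one_pow, mul_one]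
  exact (Nat.choose_le_pow m i).trans
    (Nat.le_mul_of_pos_right _ (Nat.choose_pos (Finset.mem_Iic.1 hi)))

/-- A `0`-`1` matrix with distinct rows in which no set of columns indexed by `V` is shattered has
polynomially many rows. -/
lemma card_le_of_not_shatters {ι V : Type*} [Fintype ι] [Fintype V] {m : ℕ}
    (A : ι → Fin m → Prop) (hinj : A.Injective)
    (hA : ∀ (g : Finset V → ι) (h : V → Fin m), g.Injective → h.Injective →
      ¬ ∀ s v, A (g s) (h v) ↔ v ∈ s) :
    Fintype.card ι ≤ (m + 1) ^ Fintype.card V := by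
  classical
  let B (i : ι) : Finset (Fin m) := Finset.univ.filter (A i)
  have hBmem (i j) : j ∈ B i ↔ A i j := by simp [B]
  have hB : B.Injective := fun i i' h => hinj (funext fun j => propext (by
    rw [← hBmem, ← hBmem, h]))
  let 𝒜 := Finset.univ.image B
  have hdim : 𝒜.vcDim ≤ Fintype.card V := by
    refine Finset.sup_le fun T hT => ?_
    by_contra! hlt
    -- A larger shattered set contains a shattered copy of `V`; rows realizing different subsets are
    -- different, so `g` is injective.
    obtain ⟨e⟩ : Nonempty (V ↪ T) := by
      rw [Function.Embedding.nonempty_iff_card_le, Fintype.card_coe]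
      exact hlt.le
    have hsh := Finset.mem_shatterer.1 hT
    have hex (s : Finset V) : ∃ i, ∀ v, A i (e v) ↔ v ∈ s := by
      have hsub : s.image (fun v => (e v : Fin m)) ⊆ T := by
        intro j hj
        obtain ⟨v, -, rfl⟩ := Finset.mem_image.1 hj
        exact (e v).2
      obtain ⟨u, hu, hTu⟩ := hsh hsub
      obtain ⟨i, -, rfl⟩ := Finset.mem_image.1 hu
      refine ⟨i, fun v => ?_⟩
      have := Finset.ext_iff.1 hTu (e v)
      rw [Finset.mem_inter, hBmem, Finset.mem_image] at this
      constructor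
      · intro hv
        obtain ⟨v', hv', h⟩ := this.1 ⟨(e v).2, hv⟩
        rwa [← e.injective (Subtype.ext h)]
      · intro hv
        exact (this.2 ⟨v, hv, rfl⟩).2
    choose g hg using hex
    refine hA g (fun v => e v) ?_ (Subtype.val_injective.comp e.injective) hg
    intro s s' hs
    ext v
    rw [← hg, ← hg, hs]
  calc Fintype.card ι = 𝒜.card := by
        rw [Finset.card_image_of_injective _ hB, Finset.card_univ]
    _ ≤ 𝒜.shatterer.card := Finset.card_le_card_shatterer 𝒜
    _ ≤ ∑ k ∈ Finset.Iic 𝒜.vcDim, m.choose k := by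
        simpa using Finset.card_shatterer_le_sum_vcDim (𝒜 := 𝒜)
    _ ≤ ∑ k ∈ Finset.Iic (Fintype.card V), m.choose k :=
        Finset.sum_le_sum_of_subset (Finset.Iic_subset_Iic.2 hdim)
    _ ≤ (m + 1) ^ Fintype.card V := sum_choose_le_pow _ _

/-- If `N ≤ (m + 1) ^ K` for every `m` with `N² (1 - ε) ^ m < 1`, then `N` is polynomial in
`1 / ε`. -/
lemma le_pow_of_forall_sample {K : ℕ} (hK : 0 < K) {N : ℕ} {ε : ℝ} (hε : 0 < ε) (hε1 : ε ≤ 1)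
    (h : ∀ m : ℕ, (N : ℝ) ^ 2 * (1 - ε) ^ m < 1 → N ≤ (m + 1) ^ K) :
    (N : ℝ) ≤ ((4 * K + 3) / ε) ^ (2 * K) := by
  rcases Nat.eq_zero_or_pos N with rfl | hN
  · simp only [Nat.cast_zero]; positivity
  have hN' : (1 : ℝ) ≤ N := by exact_mod_cast hN
  have hN0 : (0 : ℝ) < N := by linarith
  have hKR : (0 : ℝ) < K := by exact_mod_cast hK
  have hlog : 0 ≤ Real.log N := Real.log_nonneg hN'
  -- Chosen so that `(1 - ε) ^ m ≤ exp (-ε m) < N⁻²`.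
  set m := ⌊2 / ε * Real.log N⌋₊ + 1 with hm
  have hm1 : 2 / ε * Real.log N < m := by
    rw [hm]; push_cast; exact Nat.lt_floor_add_one _
  have hm2 : (m : ℝ) ≤ 2 / ε * Real.log N + 1 := by
    rw [hm]; push_cast
    have := Nat.floor_le (a := 2 / ε * Real.log N) (by positivity)
    linarith
  have hlt : (N : ℝ) ^ 2 * (1 - ε) ^ m < 1 := by
    have h1 : (1 - ε) ^ m ≤ Real.exp (-(ε * m)) := by
      calc (1 - ε) ^ m ≤ Real.exp (-ε) ^ m :=
            pow_le_pow_left₀ (by linarith) (Real.one_sub_le_exp_neg ε) m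
        _ = _ := by rw [← Real.exp_nat_mul]; congr 1; ring
    have h2 : Real.exp (-(ε * m)) < Real.exp (-(2 * Real.log N)) := by
      apply Real.exp_lt_exp.2
      have : 2 * Real.log N = ε * (2 / ε * Real.log N) := by field_simp
      rw [this]
      exact neg_lt_neg (mul_lt_mul_of_pos_left hm1 hε)
    have h3 : (N : ℝ) ^ 2 * Real.exp (-(2 * Real.log N)) = 1 := by
      rw [Real.exp_neg, two_mul, Real.exp_add, Real.exp_log hN0]
      field_simp
    calc (N : ℝ) ^ 2 * (1 - ε) ^ m ≤ (N : ℝ) ^ 2 * Real.exp (-(ε * m)) := by gcongr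
      _ < (N : ℝ) ^ 2 * Real.exp (-(2 * Real.log N)) := by gcongr
      _ = 1 := h3
  have hle : (N : ℝ) ≤ (m + 1) ^ K := by exact_mod_cast h m hlt
  -- Since `log N ≤ 2 K s`, `m + 1` is at most a constant times `s / ε`. Then `s ^ (2 * K) = N ≤ (m
  -- + 1) ^ K` allows cancelling `s ^ K`.
  set s : ℝ := (N : ℝ) ^ (1 / (2 * K) : ℝ) with hs
  have hs1 : 1 ≤ s := Real.one_le_rpow hN' (by positivity)
  have hsN : s ^ (2 * K) = N := by
    rw [hs, ← Real.rpow_natCast, ← Real.rpow_mul hN0.le]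
    push_cast
    rw [one_div, inv_mul_cancel₀ (by positivity), Real.rpow_one]
  have hlogs : Real.log N ≤ 2 * K * s := by
    have := Real.log_le_rpow_div hN0.le (ε := 1 / (2 * K)) (by positivity)
    rw [← hs] at this
    calc Real.log N ≤ s / (1 / (2 * K)) := this
      _ = _ := by field_simp
  have hbound : (m : ℝ) + 1 ≤ (4 * K + 3) / ε * s := by
    have h1 : 2 / ε * Real.log N ≤ 2 / ε * (2 * K * s) := by gcongr
    have h2 : (1 : ℝ) ≤ 1 / ε * s := one_le_mul_of_one_le_of_one_le
      ((one_le_div hε).2 hε1) hs1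
    calc (m : ℝ) + 1 ≤ 2 / ε * (2 * K * s) + 3 * (1 / ε * s) := by linarith
      _ = _ := by ring
  have hsq : (s ^ K) ^ 2 ≤ ((4 * K + 3) / ε) ^ K * s ^ K := by
    rw [← pow_mul, mul_comm K 2, hsN, ← mul_pow]
    exact hle.trans (by gcongr)
  have hsK : 0 < s ^ K := by positivity
  have hfin : s ^ K ≤ ((4 * K + 3) / ε) ^ K := by
    rw [sq] at hsq
    exact le_of_mul_le_mul_right hsq hsK
  calc (N : ℝ) = (s ^ K) ^ 2 := by rw [← pow_mul, mul_comm K 2, hsN]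
    _ ≤ (((4 * K + 3) / ε) ^ K) ^ 2 := by gcongr
    _ = _ := by rw [← pow_mul, mul_comm K 2]

end Sampling

/-! ### Separated sets in a pure bigraphon -/

section Packing

variable {J₁ J₂ : Type*} [MeasurableSpace J₁] [MeasurableSpace J₂]
  {π₁ : Measure J₁} {π₂ : Measure J₂} {W : J₁ → J₂ → ℝ}

/-- For 0-1 valued functions the `L₁` distance is the probability of disagreement. -/
lemma measure_eq_le_of_integral_abs_sub [IsProbabilityMeasure π₂] {f g : J₂ → ℝ}
    (hf : AEMeasurable f π₂) (hg : AEMeasurable g π₂) (hf01 : ∀ᵐ y ∂π₂, f y = 0 ∨ f y = 1)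
    (hg01 : ∀ᵐ y ∂π₂, g y = 0 ∨ g y = 1) {ε : ℝ} (h : ε ≤ ∫ y, |f y - g y| ∂π₂) :
    π₂ {y | f y = g y} ≤ ENNReal.ofReal (1 - ε) := by
  have hnull : NullMeasurableSet {y | f y = g y} π₂ := nullMeasurableSet_eq_fun hf hg
  have hae : (fun y => |f y - g y|) =ᵐ[π₂] {y | f y = g y}ᶜ.indicator 1 := by
    filter_upwards [hf01, hg01] with y hy hy'
    rcases hy with hy | hy <;> rcases hy' with hy' | hy' <;>
      simp [Set.indicator, hy, hy']
  rw [integral_congr_ae hae, integral_indicator₀ hnull.compl] at h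
  simp only [Pi.one_apply, integral_const, smul_eq_mul, mul_one, measureReal_restrict_apply_univ]
    at h
  rw [probReal_compl_eq_one_sub₀ hnull] at h
  rw [← ofReal_measureReal]
  exact ENNReal.ofReal_le_ofReal (by linarith)

/-- A set of points of the first class at mutual distance at least `ε` has size polynomial in
`1 / ε`, provided that almost surely no sample shatters a set indexed by `V`. -/
lemma card_le_of_separated [MetricSpace J₁] [IsProbabilityMeasure π₁] [IsProbabilityMeasure π₂]
    [π₁.IsOpenPosMeasure] (hrow : ∀ x, AEMeasurable (fun y => W x y) π₂)
    (hdist : ∀ x x' : J₁, dist x x' = ∫ y, |W x y - W x' y| ∂π₂)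
    (h01 : ∀ᵐ z ∂(π₁.prod π₂), W z.1 z.2 = 0 ∨ W z.1 z.2 = 1)
    {V : Type*} [Fintype V]
    (hV : ∀ᵐ z : (Finset V → J₁) × (V → J₂)
      ∂((Measure.pi fun _ => π₁).prod (Measure.pi fun _ => π₂)),
      ∃ s v, v ∈ s ∧ W (z.1 s) (z.2 v) = 0 ∨ v ∉ s ∧ W (z.1 s) (z.2 v) = 1)
    {ε : ℝ} (hε : 0 < ε) (hε1 : ε ≤ 1) (S : Finset J₁)
    (hS : ∀ x ∈ S, ∀ y ∈ S, x ≠ y → ε ≤ dist x y) :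
    (S.card : ℝ) ≤
      ((4 * (Fintype.card V + 1 : ℕ) + 3) / (ε / 2)) ^ (2 * (Fintype.card V + 1)) := by
  classical
  refine le_pow_of_forall_sample (Nat.succ_pos _) (half_pos hε) (by linarith) fun m hm => ?_
  -- generic points near the points of `S`
  have hg1 : ∀ᵐ x : S → J₁ ∂(Measure.pi fun _ => π₁),
      ∀ i, ∀ᵐ y ∂π₂, W (x i) y = 0 ∨ W (x i) y = 1 := eventually_all.2 fun i =>
    (measurePreserving_eval (fun _ : S => π₁) i).quasiMeasurePreserving.ae
      (Measure.ae_ae_of_ae_prod h01)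
  -- Only injective `g` are covered: with a repeated coordinate the tuple no longer follows the
  -- product measure.
  have hg2 : ∀ᵐ x : S → J₁ ∂(Measure.pi fun _ => π₁), ∀ g : {g : Finset V → S // g.Injective},
      ∀ᵐ y : V → J₂ ∂(Measure.pi fun _ => π₂),
        ∃ s v, v ∈ s ∧ W (x (g.1 s)) (y v) = 0 ∨ v ∉ s ∧ W (x (g.1 s)) (y v) = 1 :=
    eventually_all.2 fun g =>
      (measurePreserving_pi_comp π₁ g.2).quasiMeasurePreserving.ae (Measure.ae_ae_of_ae_prod hV)
  -- Moving each point by less than `ε / 4` leaves separation at least `ε / 2`.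
  have hbox : (Measure.pi fun _ : S => π₁) (Set.univ.pi fun i => Metric.ball i.1 (ε / 4)) ≠ 0 := by
    rw [Measure.pi_pi]
    exact Finset.prod_ne_zero_iff.2 fun i _ =>
      (Metric.isOpen_ball.measure_pos π₁ (Metric.nonempty_ball.2 (by linarith))).ne'
  obtain ⟨x, hxbox, hx1, hx2⟩ : ∃ x ∈ Set.univ.pi fun i : S => Metric.ball i.1 (ε / 4),
      (∀ i, ∀ᵐ y ∂π₂, W (x i) y = 0 ∨ W (x i) y = 1) ∧
      ∀ g : {g : Finset V → S // g.Injective}, ∀ᵐ y : V → J₂ ∂(Measure.pi fun _ => π₂),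
        ∃ s v, v ∈ s ∧ W (x (g.1 s)) (y v) = 0 ∨ v ∉ s ∧ W (x (g.1 s)) (y v) = 1 := by
    by_contra hcon
    refine hbox (measure_eq_zero_iff_ae_notMem.2 ?_)
    filter_upwards [hg1, hg2] with x h1 h2 hx
    exact hcon ⟨x, hx, h1, h2⟩
  have hsep (i i' : S) (hne : i ≠ i') : ε / 2 ≤ ∫ y, |W (x i) y - W (x i') y| ∂π₂ := by
    rw [← hdist]
    have h1 := hS i.1 i.2 i'.1 i'.2 (Subtype.coe_injective.ne hne)
    have h2 : dist (x i) i.1 < ε / 4 := hxbox i (Set.mem_univ _)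
    have h3 : dist (x i') i'.1 < ε / 4 := hxbox i' (Set.mem_univ _)
    have h4 := dist_triangle4 i.1 (x i) (x i') i'.1
    rw [dist_comm i.1 (x i)] at h4
    linarith
  -- a generic sample of the second class distinguishing these points
  have hy1 : ∀ᵐ y : Fin m → J₂ ∂(Measure.pi fun _ => π₂),
      ∀ i j, W (x i) (y j) = 0 ∨ W (x i) (y j) = 1 := eventually_all.2 fun i =>
    eventually_all.2 fun j =>
      (measurePreserving_eval (fun _ : Fin m => π₂) j).quasiMeasurePreserving.ae (hx1 i)
  have hy2 : ∀ᵐ y : Fin m → J₂ ∂(Measure.pi fun _ => π₂),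
      ∀ (g : {g : Finset V → S // g.Injective}) (h : {h : V → Fin m // h.Injective}),
        ∃ s v, v ∈ s ∧ W (x (g.1 s)) (y (h.1 v)) = 0 ∨
          v ∉ s ∧ W (x (g.1 s)) (y (h.1 v)) = 1 :=
    eventually_all.2 fun g => eventually_all.2 fun h =>
      (measurePreserving_pi_comp π₂ h.2).quasiMeasurePreserving.ae (hx2 g)
  -- Samples failing to distinguish two rows. Diagonal pairs get the empty set, since a row always
  -- agrees with itself.
  let D (q : S × S) : Set (Fin m → J₂) :=
    if q.1 = q.2 then ∅ else Set.univ.pi fun _ => {b | W (x q.1) b = W (x q.2) b}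
  have hD (q : S × S) : (Measure.pi fun _ : Fin m => π₂) (D q) ≤
      ENNReal.ofReal ((1 - ε / 2) ^ m) := by
    by_cases hq : q.1 = q.2
    · simp [D, hq]
    · simp only [D, hq, if_false]
      rw [Measure.pi_pi, Finset.prod_const, Finset.card_univ, Fintype.card_fin,
        ENNReal.ofReal_pow (by linarith)]
      exact pow_le_pow_left₀ zero_le (measure_eq_le_of_integral_abs_sub (hrow _) (hrow _)
        (hx1 _) (hx1 _) (hsep _ _ hq)) m
  have hDU : (Measure.pi fun _ : Fin m => π₂) (⋃ q, D q) < 1 := by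
    calc (Measure.pi fun _ : Fin m => π₂) (⋃ q, D q)
        ≤ ∑ q, (Measure.pi fun _ : Fin m => π₂) (D q) := measure_iUnion_fintype_le _ _
      _ ≤ ∑ _q : S × S, ENNReal.ofReal ((1 - ε / 2) ^ m) := Finset.sum_le_sum fun q _ => hD q
      _ = ENNReal.ofReal ((S.card : ℝ) ^ 2 * (1 - ε / 2) ^ m) := by
        rw [Finset.sum_const, Finset.card_univ, Fintype.card_prod, Fintype.card_coe, nsmul_eq_mul,
          ENNReal.ofReal_mul (by positivity), ← sq, Nat.cast_pow,
          ENNReal.ofReal_pow (Nat.cast_nonneg _), ENNReal.ofReal_natCast]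
      _ < 1 := by rwa [ENNReal.ofReal_lt_one]
  obtain ⟨y, hyD, hy1, hy2⟩ : ∃ y ∉ ⋃ q, D q,
      (∀ i j, W (x i) (y j) = 0 ∨ W (x i) (y j) = 1) ∧
      ∀ (g : {g : Finset V → S // g.Injective}) (h : {h : V → Fin m // h.Injective}),
        ∃ s v, v ∈ s ∧ W (x (g.1 s)) (y (h.1 v)) = 0 ∨
          v ∉ s ∧ W (x (g.1 s)) (y (h.1 v)) = 1 := by
    by_contra hcon
    refine hDU.not_ge ?_
    rw [← measure_univ (μ := Measure.pi fun _ : Fin m => π₂)]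
    refine measure_mono_ae ?_
    filter_upwards [hy1, hy2] with y h1 h2 _
    by_contra hy
    exact hcon ⟨y, hy, h1, h2⟩
  have hcard := card_le_of_not_shatters (V := V) (fun i j => W (x i) (y j) = 1) ?_ ?_
  · rw [Fintype.card_coe] at hcard
    exact hcard.trans (Nat.pow_le_pow_right (Nat.succ_pos _) (Nat.le_succ _))
  · intro i i' hii
    by_contra hne
    refine hyD (Set.mem_iUnion.2 ⟨(i, i'), ?_⟩)
    simp only [D, hne, if_false]
    intro j _
    have := congrFun hii j
    simp only [eq_iff_iff] at this
    rcases hy1 i j with h | h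
    · rcases hy1 i' j with h' | h'
      · exact h.trans h'.symm
      · exact (this.2 h').trans h'.symm
    · exact h.trans (this.1 h).symm
  · intro g h hg hh hsh
    obtain ⟨s, v, hsv⟩ := hy2 ⟨g, hg⟩ ⟨h, hh⟩
    rcases hsv with ⟨hv, h0⟩ | ⟨hv, h1⟩
    · have := (hsh s v).2 hv
      rw [h0] at this
      exact zero_ne_one this
    · exact hv ((hsh s v).1 h1)

end Packing

/-! ### From packing bounds to compactness and dimension -/

section MetricSpace

variable {M : Type*} [MetricSpace M]

/-- A separated set of maximal size is a finite net, as any uncovered point could be added to it. -/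
lemma compactSpace_of_card_le_of_separated [CompleteSpace M] {δ : ℝ} (hδ : 0 < δ) {N : ℝ → ℝ}
    (h : ∀ ε, 0 < ε → ε ≤ δ → ∀ S : Finset M, (∀ x ∈ S, ∀ y ∈ S, x ≠ y → ε ≤ dist x y) →
      (S.card : ℝ) ≤ N ε) : CompactSpace M := by
  classical
  rw [← isCompact_univ_iff, isCompact_iff_totallyBounded_isComplete]
  refine ⟨Metric.totallyBounded_iff.2 fun r hr => ?_, isComplete_univ⟩
  let ε := min r δ
  have hε : 0 < ε := lt_min hr hδ
  let p (n : ℕ) : Prop :=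
    ∃ S : Finset M, (∀ x ∈ S, ∀ y ∈ S, x ≠ y → ε ≤ dist x y) ∧ S.card = n
  have hp0 : p 0 := ⟨∅, by simp⟩
  have hpb (n) (hn : p n) : n ≤ ⌊N ε⌋₊ := by
    obtain ⟨S, hS, rfl⟩ := hn
    exact Nat.le_floor (h ε hε (min_le_right _ _) S hS)
  obtain ⟨S, hS, hcard⟩ := Nat.findGreatest_spec (P := p) (Nat.zero_le ⌊N ε⌋₊) hp0
  refine ⟨S, S.finite_toSet, fun x _ => ?_⟩
  by_contra hx
  simp only [Set.mem_iUnion, Metric.mem_ball, not_exists, not_lt] at hx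
  have hxS (y) (hy : y ∈ S) : ε ≤ dist x y := (min_le_left _ _).trans (hx y hy)
  have hxn : x ∉ S := fun hmem => by
    have := hxS x hmem
    rw [dist_self] at this
    exact hε.not_ge this
  have hp : p (S.card + 1) := by
    refine ⟨insert x S, ?_, Finset.card_insert_of_notMem hxn⟩
    intro a ha b hb hab
    rcases Finset.mem_insert.1 ha with rfl | ha' <;> rcases Finset.mem_insert.1 hb with rfl | hb'
    · exact absurd rfl hab
    · exact hxS b hb'
    · rw [dist_comm]
      exact hxS a ha'
    · exact hS a ha' b hb' hab
  have := Nat.le_findGreatest (hpb _ hp) hp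
  omega

/-- For `ε` small, `C ≤ 1 / ε`, so the constant is absorbed by doubling the exponent. -/
lemma packingDim_le_of_card_le {C : ℝ} (hC : 1 ≤ C) {k : ℕ}
    (h : ∀ ε, 0 < ε → ε ≤ 1 → ∀ S : Finset M, (∀ x ∈ S, ∀ y ∈ S, x ≠ y → ε ≤ dist x y) →
      (S.card : ℝ) ≤ (C / ε) ^ k) : packingDim M ≤ ((2 * k : ℝ) : EReal) := by
  refine limsup_le_of_le (by isBoundedDefault) ?_
  have hC0 : 0 < C := by linarith
  have hlt : (0 : ℝ) < (C + 1)⁻¹ := by positivity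
  filter_upwards [Ioo_mem_nhdsGT hlt] with ε hε
  have hε0 : 0 < ε := hε.1
  have hεC : C + 1 < 1 / ε := by
    rw [one_div]
    exact (lt_inv_comm₀ hε0 (by positivity)).1 hε.2
  have hε1 : ε ≤ 1 := hε.2.le.trans (inv_le_one_of_one_le₀ (by linarith))
  have hlog : 0 < Real.log (1 / ε) := Real.log_pos (by linarith)
  have hcount : ((packingCount M ε : ℕ∞) : ℝ≥0∞) ≤ ENNReal.ofReal ((1 / ε) ^ (2 * k)) := by
    have hle : packingCount M ε ≤ (⌊(1 / ε) ^ (2 * k)⌋₊ : ℕ∞) := by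
      refine iSup₂_le fun S hS => ?_
      refine Nat.cast_le.2 (Nat.le_floor ((h ε hε0 hε1 S hS).trans ?_))
      rw [pow_mul]
      refine pow_le_pow_left₀ (by positivity) ?_ k
      calc C / ε = C * (1 / ε) := by ring
        _ ≤ (1 / ε) * (1 / ε) := by gcongr; linarith
        _ = _ := by ring
    calc ((packingCount M ε : ℕ∞) : ℝ≥0∞) ≤ ((⌊(1 / ε) ^ (2 * k)⌋₊ : ℕ∞) : ℝ≥0∞) :=
          ENat.toENNReal_le.2 hle
      _ = ENNReal.ofReal (⌊(1 / ε) ^ (2 * k)⌋₊ : ℝ) := by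
          rw [ENat.toENNReal_coe, ENNReal.ofReal_natCast]
      _ ≤ _ := ENNReal.ofReal_le_ofReal (Nat.floor_le (by positivity))
  rw [EReal.div_le_iff_le_mul (by exact_mod_cast hlog) (EReal.coe_ne_top _)]
  refine (ENNReal.log_le_log hcount).trans ?_
  rw [ENNReal.log_ofReal_of_pos (by positivity), Real.log_pow, ← EReal.coe_mul,
    EReal.coe_le_coe_iff]
  push_cast
  linarith

end MetricSpace

/-! ### Assembling both classes -/

theorem corollary4p3 (P : Bigraph → Prop) (hP : Bigraph.IsHereditary P)
    (hne : ∃ F : Bigraph, ¬ P F) :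
    ∃ d : ℝ, ∀ (J₁ J₂ : Type*) [MeasurableSpace J₁] [MeasurableSpace J₂]
      [MetricSpace J₁] [MetricSpace J₂]
      (π₁ : Measure J₁) (π₂ : Measure J₂) (W : J₁ → J₂ → ℝ),
      IsPureBigraphon π₁ π₂ W → InClosure P π₁ π₂ W →
        (∀ᵐ p ∂(π₁.prod π₂), W p.1 p.2 = 0 ∨ W p.1 p.2 = 1) ∧
        CompactSpace J₁ ∧ CompactSpace J₂ ∧
        packingDim J₁ ≤ (d : EReal) ∧ packingDim J₂ ≤ (d : EReal) := by
  obtain ⟨V, _, hV₁, hV₂⟩ := hP.exists_not_ofSubsets hne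
  -- The `+ 1` keeps the exponent positive when `V` is empty. In the bound below, `2 * K` is the
  -- sampling exponent and the outer 2 absorbs the constant.
  let K := Fintype.card V + 1
  refine ⟨2 * (2 * K : ℕ), fun J₁ J₂ _ _ _ _ π₁ π₂ W hW hcl => ?_⟩
  have := hW.prob₁
  have := hW.prob₂
  have := hW.complete₁
  have := hW.complete₂
  have := hW.open_pos₁
  have := hW.open_pos₂
  have htf := Bigraph.isTwinFree_ofSubsets V
  have hs₁ : ∀ᵐ z : (Finset V → J₁) × (V → J₂)
      ∂((Measure.pi fun _ => π₁).prod (Measure.pi fun _ => π₂)),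
      ∃ s v, v ∈ s ∧ W (z.1 s) (z.2 v) = 0 ∨ v ∉ s ∧ W (z.1 s) (z.2 v) = 1 :=
    hW.ae_exists_of_inClosure hP hcl htf hV₁
  have hs₂' : ∀ᵐ z : (V → J₁) × (Finset V → J₂)
      ∂((Measure.pi fun _ => π₁).prod (Measure.pi fun _ => π₂)),
      ∃ v s, v ∈ s ∧ W (z.1 v) (z.2 s) = 0 ∨ v ∉ s ∧ W (z.1 v) (z.2 s) = 1 :=
    hW.ae_exists_of_inClosure hP hcl htf.flip hV₂
  have hs₂ : ∀ᵐ z : (Finset V → J₂) × (V → J₁)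
      ∂((Measure.pi fun _ => π₂).prod (Measure.pi fun _ => π₁)),
      ∃ s v, v ∈ s ∧ W (z.2 v) (z.1 s) = 0 ∨ v ∉ s ∧ W (z.2 v) (z.1 s) = 1 := by
    filter_upwards [Measure.measurePreserving_swap.quasiMeasurePreserving.ae hs₂'] with z hz
    obtain ⟨v, s, h⟩ := hz
    exact ⟨s, v, h⟩
  have h01 : ∀ᵐ p ∂(π₁.prod π₂), W p.1 p.2 = 0 ∨ W p.1 p.2 = 1 := by
    refine hW.ae_zero_or_one (ι := Finset V) (κ := V) ?_
    filter_upwards [hs₁] with z hz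
    obtain ⟨s, v, h⟩ := hz
    exact ⟨s, v, h.imp And.right And.right⟩
  have h01' : ∀ᵐ p ∂(π₂.prod π₁), W p.2 p.1 = 0 ∨ W p.2 p.1 = 1 :=
    Measure.measurePreserving_swap.quasiMeasurePreserving.ae h01
  let C : ℝ := 2 * (4 * K + 3)
  have hC : 1 ≤ C := by
    have : (0 : ℝ) ≤ K := Nat.cast_nonneg _
    simp only [C]
    linarith
  have hCε (ε : ℝ) : (4 * (K : ℝ) + 3) / (ε / 2) = C / ε := by
    simp only [C]
    rw [div_div_eq_mul_div]
    ring
  have b₁ (ε : ℝ) (hε : 0 < ε) (hε1 : ε ≤ 1) (S : Finset J₁)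
      (hS : ∀ x ∈ S, ∀ y ∈ S, x ≠ y → ε ≤ dist x y) : (S.card : ℝ) ≤ (C / ε) ^ (2 * K) := by
    rw [← hCε]
    exact card_le_of_separated hW.aemeasurable_row hW.dist_eq₁ h01 hs₁ hε hε1 S hS
  have b₂ (ε : ℝ) (hε : 0 < ε) (hε1 : ε ≤ 1) (S : Finset J₂)
      (hS : ∀ x ∈ S, ∀ y ∈ S, x ≠ y → ε ≤ dist x y) : (S.card : ℝ) ≤ (C / ε) ^ (2 * K) := by
    rw [← hCε]
    exact card_le_of_separated (W := fun y x => W x y) hW.aemeasurable_col hW.dist_eq₂ h01' hs₂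
      hε hε1 S hS
  exact ⟨h01, compactSpace_of_card_le_of_separated one_pos b₁,
    compactSpace_of_card_le_of_separated one_pos b₂,
    packingDim_le_of_card_le hC b₁, packingDim_le_of_card_le hC b₂⟩
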